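/- A ribbon graph $\mathbb{G}=(V(\mathbb{G}),E(\mathbb{G}))$ is a compact surface with boundary presented as a finite union of vertex discs and edge discs, where vertices and edges meet in disjoint line segments, each segment lies on the boundary of precisely one vertex and one edge, and every edge contains exactly two segments. Ribbon graphs are considered up to homeomorphisms preserving vertices and edges. $\mathbb{G}\backslash e$ is obtained by deleting the edge $e$. $\mathbb{G}/e$ is obtained as follows: if $u,v$ are the (not necessarily distinct) vertices incident with $e$, attach a disc, as a new vertex, to each boundary curve of $e\cup u\cup v$, and then delete $e,u,v$. For $A\subseteq E(\mathbb{G})$, $\mathbb{G}\backslash A$ and $\mathbb{G}/A$ denote the results of deleting, respectively contracting, all edges of $A$, and $A^c=E(\mathbb{G})\backslash A$. A class of ribbon graphs is minor-closed if it is closed under deletion and contraction of edges. There are three connected ribbon graphs with exactly one edge: $\mathrm{b}$ (the edge joins two vertices), $\mathrm{ol}$ (an orientable loop, i.e. an annulus) and $\mathrm{nl}$ (a non-orientable loop, i.e. a Möbius band). An edge $e$ of $\mathbb{G}$ is of type $(i,j)$, with $i,j\in\{\mathrm{b},\mathrm{ol},\mathrm{nl}\}$, if $(\mathbb{G}/e^c,\mathbb{G}\backslash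 e^c)=(i,j)$ after disregarding isolated vertices. Let $v$, $|E|$, $k$, $b$ be the numbers of vertices, edges, connected components and boundary components of $\mathbb{G}$, and put $\rho(\mathbb{G})=(v-k)+\tfrac12\gamma_{\mathrm{Eu}}(\mathbb{G})$, where $\gamma_{\mathrm{Eu}}(\mathbb{G})=2k-v+|E|-b$ is the Euler genus. For $A\subseteq E(\mathbb{G})$ put $\rho(A)=\rho(\mathbb{G}\backslash A^c)$. Define \[T_{cs}(\mathbb{G};x,y)=\sum_{A\subseteq E(\mathbb{G})}x^{\rho(\mathbb{G})-\rho(A)}\,y^{|A|-\rho(A)},\] a polynomial in $x^{1/2}$ and $y^{1/2}$. **Theorem (Universality).** Let $\mathcal{G}$ be a minor-closed class of ribbon graphs. Then there is a unique map $U:\mathcal{G}\to\mathbb{Z}[\gamma,a_{\mathrm b}^{1/2},a_{\mathrm{ol}}^{1/2},b_{\mathrm b}^{1/2},b_{\mathrm{ol}}^{1/2}]$ such that \[U(\mathbb{G})=\begin{cases}a_i\,U(\mathbb{G}\backslash e)+b_j\,U(\mathbb{G}/e)&\text{if } e \text{ is an edge of } \mathbb{G} \text{ of type }(i,j),\\ \gamma^{v(\mathbb{G})}&\text{if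 }\mathbb{G}\text{ is edgeless,}\end{cases}\] where $a_{\mathrm{nl}}=a_{\mathrm b}^{1/2}a_{\mathrm{ol}}^{1/2}$ and $b_{\mathrm{nl}}=b_{\mathrm b}^{1/2}b_{\mathrm{ol}}^{1/2}$ (the first equation is required for every edge $e$ of $\mathbb{G}$). Moreover \[U(\mathbb{G})=\gamma^{v(\mathbb{G})-\rho(\mathbb{G})}\,b_{\mathrm b}^{\rho(\mathbb{G})}\,a_{\mathrm{ol}}^{|E|-\rho(\mathbb{G})}\;T_{cs}\!\left(\mathbb{G};\frac{\gamma\,a_{\mathrm b}}{b_{\mathrm b}},\frac{\gamma\,b_{\mathrm{ol}}}{a_{\mathrm{ol}}}\right),\] where half-integral powers are taken with respect to the given square roots of $a_{\mathrm b},a_{\mathrm{ol}},b_{\mathrm b},b_{\mathrm{ol}}$ and one fixed square root of $\gamma$. -/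

import Mathlib

open Function

universe u v w

noncomputable section

namespace RibbonGraph

/-! ### Rerouting an involution around a set of points -/

section Reroute

variable {C : Type u} (arc d : C → C) (S : Set C)

open Classical in
/-- One step of the walk: inside `S` first apply the detour `d`, then follow an arc. -/
def walkStep (c : C) : C := arc (if c ∈ S then d c else c)

/-- Number of points of `S` that the walk starting at `c` meets before it leaves `S` for the
first time. -/
def returnTime (c : C) : ℕ := sInf {n | (walkStep arc d S)^[n + 1] c ∉ S}

/-- The first point outside `S` that is met by the walk starting at `c`:
`arc c` if this is not in `S`, else `arc (d (arc c))` if this is not in `S`, and so on. -/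
def reroute (c : C) : C := (walkStep arc d S)^[returnTime arc d S c + 1] c

variable {arc d S}

lemma walkStep_injective (harc : Involutive arc) (hd : Involutive d)
    (hS : ∀ c, d c ∈ S ↔ c ∈ S) : Injective (walkStep arc d S) := by
  intro a b h
  have h' := harc.injective h
  by_cases ha : a ∈ S <;> by_cases hb : b ∈ S <;> simp only [ha, hb, if_true, if_false] at h'
  · exact hd.injective h'
  · exact absurd (h' ▸ (hS a).2 ha) hb
  · exact absurd (h'.symm ▸ (hS b).2 hb) ha
  · exact h'

lemma return_nonempty [Finite C] (harc : Involutive arc) (hd : Involutive d)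
    (hS : ∀ c, d c ∈ S ↔ c ∈ S) {c : C} (hc : c ∉ S) :
    {n | (walkStep arc d S)^[n + 1] c ∉ S}.Nonempty := by
  obtain ⟨n, hn, hp⟩ := (walkStep_injective harc hd hS).mem_periodicPts c
  obtain ⟨m, rfl⟩ := Nat.exists_eq_succ_of_ne_zero hn.ne'
  refine ⟨m, ?_⟩
  show (walkStep arc d S)^[m + 1] c ∉ S
  rw [hp.eq]
  exact hc

lemma reroute_notMem [Finite C] (harc : Involutive arc) (hd : Involutive d)
    (hS : ∀ c, d c ∈ S ↔ c ∈ S) {c : C} (hc : c ∉ S) : reroute arc d S c ∉ S :=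
  Nat.sInf_mem (return_nonempty harc hd hS hc)

lemma mem_of_lt_return {c : C} {k : ℕ} (hk : k < returnTime arc d S c) :
    (walkStep arc d S)^[k + 1] c ∈ S := by
  by_contra h
  exact Nat.notMem_of_lt_sInf hk h

open Classical in
lemma walkStep_reverse (harc : Involutive arc) (hd : Involutive d)
    (hS : ∀ c, d c ∈ S ↔ c ∈ S) (k : ℕ) (c : C) :
    (walkStep arc d S)^[k] (if (walkStep arc d S)^[k] c ∈ S then d ((walkStep arc d S)^[k] c)
      else (walkStep arc d S)^[k] c) = if c ∈ S then d c else c := by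
  have key : ∀ x, walkStep arc d S (if walkStep arc d S x ∈ S then d (walkStep arc d S x)
      else walkStep arc d S x) = if x ∈ S then d x else x := by
    intro x
    by_cases h : walkStep arc d S x ∈ S
    · have h2 : d (walkStep arc d S x) ∈ S := (hS _).2 h
      simp only [h, if_true]
      conv_lhs => unfold walkStep
      rw [if_pos (by simpa [walkStep] using h2), hd, harc]
    · simp only [h, if_false]
      conv_lhs => unfold walkStep
      rw [if_neg (by simpa [walkStep] using h), harc]
  induction k generalizing c with
  | zero => rfl
  | succ k ih =>
    simp only [iterate_succ_apply' (walkStep arc d S) k c]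
    rw [iterate_succ_apply, key, ih]

lemma reroute_reroute [Finite C] (harc : Involutive arc) (hd : Involutive d)
    (hS : ∀ c, d c ∈ S ↔ c ∈ S) {c : C} (hc : c ∉ S) :
    reroute arc d S (reroute arc d S c) = c := by
  have hg := reroute_notMem harc hd hS hc
  have hback : (walkStep arc d S)^[returnTime arc d S c + 1] (reroute arc d S c) = c := by
    have := walkStep_reverse harc hd hS (returnTime arc d S c + 1) c
    rwa [if_neg hc, if_neg (show (walkStep arc d S)^[returnTime arc d S c + 1] c ∉ S from hg)]
      at this
  have hmid : ∀ k < returnTime arc d S c,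
      (walkStep arc d S)^[k + 1] (reroute arc d S c) ∈ S := by
    intro k hk
    have hmem : (walkStep arc d S)^[returnTime arc d S c - (k + 1) + 1] c ∈ S :=
      mem_of_lt_return (by omega)
    have e : reroute arc d S c = (walkStep arc d S)^[k + 1]
        ((walkStep arc d S)^[returnTime arc d S c - (k + 1) + 1] c) := by
      have hk' : k + 1 + (returnTime arc d S c - (k + 1) + 1) = returnTime arc d S c + 1 := by
        omega
      rw [← iterate_add_apply, hk', reroute]
    have := walkStep_reverse harc hd hS (k + 1)
      ((walkStep arc d S)^[returnTime arc d S c - (k + 1) + 1] c)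
    rw [← e, if_neg hg, if_pos hmem] at this
    rw [this]
    exact (hS _).2 hmem
  have ht : returnTime arc d S (reroute arc d S c) = returnTime arc d S c := by
    apply le_antisymm
    · apply Nat.sInf_le
      show _ ∉ S
      rw [hback]
      exact hc
    · by_contra! h
      exact reroute_notMem harc hd hS hg (hmid _ h)
  conv_lhs => rw [reroute, ht]
  exact hback

lemma reroute_ne [Finite C] (harc : Involutive arc) (harc' : ∀ c, arc c ≠ c)
    (hd : Involutive d) (hd' : ∀ c, d c ≠ c) (hS : ∀ c, d c ∈ S ↔ c ∈ S) {c : C}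
    (hc : c ∉ S) : reroute arc d S c ≠ c := by
  intro h
  have hinj := walkStep_injective harc hd hS
  rcases Nat.even_or_odd' (returnTime arc d S c + 1) with ⟨m, hm | hm⟩
  · obtain ⟨j, rfl⟩ : ∃ j, m = j + 1 := ⟨m - 1, by omega⟩
    have hmem : (walkStep arc d S)^[j + 1] c ∈ S := mem_of_lt_return (by omega)
    have h1 := walkStep_reverse harc hd hS (j + 1) c
    rw [if_pos hmem, if_neg hc] at h1
    have h2 : (walkStep arc d S)^[j + 1] ((walkStep arc d S)^[j + 1] c) = c := by
      rw [← iterate_add_apply, ← two_mul, ← hm]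
      exact h
    exact hd' _ (hinj.iterate (j + 1) (h1.trans h2.symm))
  · have h1 := walkStep_reverse harc hd hS m c
    rw [if_neg hc] at h1
    have h2 : (walkStep arc d S)^[m] (walkStep arc d S ((walkStep arc d S)^[m] c)) = c := by
      rw [← iterate_succ_apply, ← iterate_add_apply]
      have : m.succ + m = returnTime arc d S c + 1 := by omega
      rw [this]
      exact h
    have h3 := hinj.iterate m (h2.trans h1.symm)
    exact harc' _ h3

end Reroute

end RibbonGraph

/-! ### Ribbon graphs -/

/-- A (finite) ribbon graph, up to homeomorphism.  Every edge disc is parametrised as a rectangle;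
the corner `(e, i, s)` of the edge `e` lies at the end `i` and on the side `s` of `e`, so that the
two line segments in which `e` meets the vertices join `(e, i, false)` to `(e, i, true)`, and the
two sides of `e` join `(e, false, s)` to `(e, true, s)`.  The remaining parts of the boundaries of
those vertices that meet some edge are arcs, each of which joins two corners; they are recorded by
a fixed-point-free involution `arc` of the corners, which may be arbitrary.  Vertices that meet no
edge carry no further structure, and only their number `isolated` is recorded. -/
structure RibbonGraph where
  E : Type u
  finite_E : Finite E
  arc : E × Bool × Bool → E × Bool × Bool
  arc_arc : Involutive arc
  arc_ne : ∀ c, arc c ≠ c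
  isolated : ℕ

namespace RibbonGraph

attribute [instance] RibbonGraph.finite_E

instance (G : RibbonGraph.{u}) : Fintype G.E := Fintype.ofFinite G.E

/-- The corner joined to `c` by a line segment in which its edge meets a vertex. -/
def acrossEnd {E : Type u} (c : E × Bool × Bool) : E × Bool × Bool := (c.1, c.2.1, !c.2.2)

/-- The corner joined to `c` by a side of its edge. -/
def alongSide {E : Type u} (c : E × Bool × Bool) : E × Bool × Bool := (c.1, !c.2.1, c.2.2)

variable (G : RibbonGraph.{u})

/-- The set `V(G)` of vertices: the closed curves formed by arcs and line segments, together with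
the isolated vertices. -/
abbrev Vertex : Type u :=
  Quot (fun c c' : G.E × Bool × Bool => c' = G.arc c ∨ c' = acrossEnd c) ⊕ Fin G.isolated

/-- The set `F(G)` of boundary components: the closed curves formed by arcs and sides of edges,
together with the boundaries of the isolated vertices. -/
abbrev Boundary : Type u :=
  Quot (fun c c' : G.E × Bool × Bool => c' = G.arc c ∨ c' = alongSide c) ⊕ Fin G.isolated

/-- The set of connected components. -/
abbrev Component : Type u :=
  Quot (fun c c' : G.E × Bool × Bool => c' = G.arc c ∨ c' = acrossEnd c ∨ c' = alongSide c) ⊕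
    Fin G.isolated

/-- Equivalence of ribbon graphs: a homeomorphism mapping vertices to vertices and edges to edges
is determined, up to isotopy, by what it does to the corners and to the isolated vertices. -/
def Equivalent (G : RibbonGraph.{u}) (H : RibbonGraph.{v}) : Prop :=
  (∃ φ : G.E × Bool × Bool ≃ H.E × Bool × Bool,
    (∀ c, φ (G.arc c) = H.arc (φ c)) ∧ (∀ c, φ (acrossEnd c) = acrossEnd (φ c)) ∧
      ∀ c, φ (alongSide c) = alongSide (φ c)) ∧
  G.isolated = H.isolated

/-- Inclusion of the corners of the edges outside `S` into all corners. -/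
def liftCorner {E : Type u} {S : Set E} (c : {e // e ∉ S} × Bool × Bool) : E × Bool × Bool :=
  (c.1.1, c.2)

/-- Remove the edges in `S` and let the vertices be bounded by the curves which follow arcs and
which, at a corner `c` of an edge in `S`, continue with `d c`.  Curves which meet only edges in
`S` bound isolated vertices. -/
def remove (S : Set G.E) (d : G.E × Bool × Bool → G.E × Bool × Bool) (hd : Involutive d)
    (hd' : ∀ c, d c ≠ c) (hdE : ∀ c, (d c).1 = c.1) : RibbonGraph.{u} where
  E := {e // e ∉ S}
  finite_E := inferInstance
  arc c := (⟨(reroute G.arc d {x | x.1 ∈ S} (liftCorner c)).1,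
    reroute_notMem (S := {x : G.E × Bool × Bool | x.1 ∈ S}) G.arc_arc hd
      (fun x => by simp only [Set.mem_ofPred_eq, hdE x]) (c := liftCorner c) c.1.2⟩,
    (reroute G.arc d {x | x.1 ∈ S} (liftCorner c)).2)
  arc_arc c := by
    have h := reroute_reroute (S := {x : G.E × Bool × Bool | x.1 ∈ S}) G.arc_arc hd
      (fun x => by simp only [Set.mem_ofPred_eq, hdE x]) (c := liftCorner c) c.1.2
    exact Prod.ext (Subtype.ext (congrArg (fun x => x.1) h)) (congrArg (fun x => x.2) h)
  arc_ne c h := by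
    refine reroute_ne (S := {x : G.E × Bool × Bool | x.1 ∈ S}) G.arc_arc G.arc_ne hd hd'
      (fun x => by simp only [Set.mem_ofPred_eq, hdE x]) (c := liftCorner c) c.1.2
      (Prod.ext ?_ ?_)
    · exact congrArg (fun x => x.1.1) h
    · exact congrArg (fun x => x.2) h
  isolated := G.isolated +
    Nat.card {q : Quot (fun c c' : G.E × Bool × Bool => c' = G.arc c ∨ c.1 ∈ S ∧ c' = d c) //
      ∀ c, Quot.mk _ c = q → c.1 ∈ S}

/-- The ribbon graph `G \ S`: delete the edges in `S`.  The boundary of a vertex is followed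
straight through the line segments of deleted edges. -/
def delete (S : Set G.E) : RibbonGraph.{u} :=
  G.remove S acrossEnd (fun c => by simp [acrossEnd]) (fun c h => by simp [acrossEnd, Prod.ext_iff] at h)
    (fun _ => rfl)

/-- The ribbon graph `G / S`: contract the edges in `S`.  The vertices are the discs bounded by
the boundary curves of the union of the vertices of `G` and the edges in `S`; these curves
follow the sides of the edges in `S`. -/
def contract (S : Set G.E) : RibbonGraph.{u} :=
  G.remove S alongSide (fun c => by simp [alongSide]) (fun c h => by simp [alongSide, Prod.ext_iff] at h)
    (fun _ => rfl)

/-- Disregard the isolated vertices. -/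
def dropIsolated : RibbonGraph.{u} := { G with isolated := 0 }

/-! ### One-edge ribbon graphs and edge types -/

/-- Names of the three connected ribbon graphs with one edge: `b` (a bridge joining two vertices),
`ol` (an orientable loop, an annulus), `nl` (a non-orientable loop, a Möbius band). -/
inductive Kind
  | b
  | ol
  | nl

/-- The connected ribbon graphs with one edge. For `b`, an arc closes up each end of the edge to a
vertex; for `ol` and `nl`, there is one vertex, whose two arcs join the two ends of the edge, so
that they connect corners on the same side and on different sides, respectively. -/
def oneEdge (k : Kind) : RibbonGraph.{0} where
  E := Unit
  finite_E := inferInstance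
  arc c := match k with
    | .b => (c.1, c.2.1, !c.2.2)
    | .ol => (c.1, !c.2.1, c.2.2)
    | .nl => (c.1, !c.2.1, !c.2.2)
  arc_arc c := by cases k <;> simp
  arc_ne c h := by cases k <;> simp [Prod.ext_iff] at h
  isolated := 0

/-- The edge `e` is of type `(i, j)`: the pair `(G / eᶜ, G \ eᶜ)` is `(i, j)` after disregarding
isolated vertices. -/
def IsType (e : G.E) (i j : Kind) : Prop :=
  (G.contract {e}ᶜ).dropIsolated.Equivalent (oneEdge i) ∧
    (G.delete {e}ᶜ).dropIsolated.Equivalent (oneEdge j)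

/-! ### Parameters and the polynomial -/

/-- `v(G)` -/
def numV : ℕ := Nat.card G.Vertex

/-- `|E(G)|` -/
def numE : ℕ := Nat.card G.E

/-- `b(G)` -/
def numB : ℕ := Nat.card G.Boundary

/-- `k(G)` -/
def numK : ℕ := Nat.card G.Component

/-- The rank `r(G) = v(G) - k(G)` of the underlying graph. -/
def rank : ℤ := G.numV - G.numK

/-- The Euler genus of `G`: twice the number of components minus the Euler characteristic
`v(G) - |E(G)| + b(G)` of the closed surface obtained by capping the boundary components. -/
def eulerGenus : ℤ := 2 * G.numK - (G.numV - G.numE + G.numB)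

/-- `2ρ(G)`, where `ρ(G) = r(G) + γ(G) / 2` with `γ(G)` the Euler genus.  (The number `ρ(G)` need
not be an integer.) -/
def twoRho : ℤ := 2 * G.rank + G.eulerGenus

/-- `2ρ(A)`, where `ρ(A) = ρ(G \ Aᶜ)`. -/
def twoRhoOf (A : Set G.E) : ℤ := (G.delete Aᶜ).twoRho

/-- The Tutte polynomial `T_cs(G; x, y) = ∑_A x ^ (ρ(G) - ρ(A)) y ^ (|A| - ρ(A))` of a ribbon graph.
It is a polynomial in `x ^ (1/2)` and `y ^ (1/2)`; the arguments `sx` and `sy` are the values of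
these square roots, so that `x = sx ^ 2` and `y = sy ^ 2`. -/
def tutteCS {K : Type v} [Field K] (sx sy : K) : K :=
  ∑ A : Set G.E, sx ^ (G.twoRho - G.twoRhoOf A) * sy ^ (2 * (A.ncard : ℤ) - G.twoRhoOf A)

/-! ### The recursion -/

/-- A class of ribbon graphs closed under deletion and contraction of edges. -/
structure MinorClosed (𝒢 : Set RibbonGraph.{u}) : Prop where
  delete : ∀ {G : RibbonGraph.{u}}, G ∈ 𝒢 → ∀ e : G.E, G.delete {e} ∈ 𝒢
  contract : ∀ {G : RibbonGraph.{u}}, G ∈ 𝒢 → ∀ e : G.E, G.contract {e} ∈ 𝒢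

/-- The indeterminates `γ`, `a_b ^ (1/2)`, `a_ol ^ (1/2)`, `b_b ^ (1/2)`, `b_ol ^ (1/2)`. -/
inductive Indet
  | gamma
  | sqrtAb
  | sqrtAol
  | sqrtBb
  | sqrtBol

/-- The ring `ℤ[γ, a_b ^ (1/2), a_ol ^ (1/2), b_b ^ (1/2), b_ol ^ (1/2)]`. -/
abbrev Coeff : Type := MvPolynomial Indet ℤ

open MvPolynomial in
/-- The coefficients `a_b`, `a_ol` and `a_nl = a_b ^ (1/2) a_ol ^ (1/2)`. -/
def aCoeff : Kind → Coeff
  | .b => X .sqrtAb ^ 2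
  | .ol => X .sqrtAol ^ 2
  | .nl => X .sqrtAb * X .sqrtAol

open MvPolynomial in
/-- The coefficients `b_b`, `b_ol` and `b_nl = b_b ^ (1/2) b_ol ^ (1/2)`. -/
def bCoeff : Kind → Coeff
  | .b => X .sqrtBb ^ 2
  | .ol => X .sqrtBol ^ 2
  | .nl => X .sqrtBb * X .sqrtBol

/-- `U` satisfies the deletion-contraction recursion on the minor-closed class `𝒢`. -/
structure SatisfiesRecursion {𝒢 : Set RibbonGraph.{u}} (h𝒢 : MinorClosed 𝒢) (U : 𝒢 → Coeff) :
    Prop where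
  deletion_contraction : ∀ (G : 𝒢) (e : G.1.E) (i j : Kind), G.1.IsType e i j →
    U G = aCoeff i * U ⟨G.1.delete {e}, h𝒢.delete G.2 e⟩
      + bCoeff j * U ⟨G.1.contract {e}, h𝒢.contract G.2 e⟩
  edgeless : ∀ G : 𝒢, IsEmpty G.1.E → U G = MvPolynomial.X .gamma ^ G.1.numV

end RibbonGraph

end

/-! For a set `A` of edges let f(A) be the number of boundary components of the spanning ribbon
subgraph on `A` (`loops`). Then v = f(∅) and b = f(E), and minors transform f simply: f on G\e is
f(A), and f on G/e is f(A ∪ e) (`loops_delete`, `loops_contract`). Hence every quantity in the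
theorem can be expressed through f and numbers of edges; the number of components cancels in ρ.

An edge of type (i,j) satisfies f(E) - f(E \ e) = shift(i) and f({e}) - f(∅) = shift(j), where the
shift is -1, 1, 0 for b, ol, nl. So there is a closed solution: the sum over all A of γ^f(A) times a
monomial in the four square roots whose exponents are linear in |E|, v, b, |A|, f(A) (`stateSum`).
Splitting the sum according to whether e lies in A gives the recursion for every e at once
(`stateSum_eq`), so no consistency between different orders of reduction has to be checked. The
exponents are nonnegative because adding one edge changes f by at most 1
(`abs_loops_insert_sub_le`).

Uniqueness is induction on |E|, since every edge has a type (`exists_isType`). The formula with T_cs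
holds term by term after substituting 2ρ(A) = v + |A| - f(A) (`map_stateWeight`). -/

noncomputable section

namespace RibbonGraph

/-! ### Loops of a rerouted involution -/

section Reroute

variable {C : Type u} {arc d : C → C} {S : Set C}

lemma quot_mk_reroute_eq {r : C → C → Prop} (harc : ∀ c, r c (arc c))
    (hd : ∀ c ∈ S, r c (d c)) (c : C) : Quot.mk r (reroute arc d S c) = Quot.mk r c := by
  have hstep : ∀ c, Quot.mk r (walkStep arc d S c) = Quot.mk r c := by
    intro c
    unfold walkStep
    split_ifs with h
    · exact (Quot.sound (harc _)).symm.trans (Quot.sound (hd c h)).symm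
    · exact (Quot.sound (harc c)).symm
  have hiter : ∀ n, Quot.mk r ((walkStep arc d S)^[n] c) = Quot.mk r c := by
    intro n
    induction n with
    | zero => rfl
    | succ n ih => rw [iterate_succ_apply', hstep, ih]
  exact hiter _

/-- A curve of arcs and detours inside `S` meets the complement of `S` only in its two ends. -/
lemma eq_or_eq_reroute [Finite C] (harc : Involutive arc) (hd : Involutive d)
    (hS : ∀ c, d c ∈ S ↔ c ∈ S) {a b : C} (ha : a ∉ S) (hb : b ∉ S)
    (h : Quot.mk (fun c c' => c' = arc c ∨ c ∈ S ∧ c' = d c) a = Quot.mk _ b) :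
    b = a ∨ b = reroute arc d S a := by
  classical
  set r : C → C → Prop := fun c c' => c' = arc c ∨ c ∈ S ∧ c' = d c with hr
  let σ : C → C := fun c => if c ∈ S then d c else c
  have hσσ : ∀ c, σ (σ c) = c := by
    intro c
    by_cases hc : c ∈ S
    · simp [σ, hc, hS, hd c]
    · simp [σ, hc]
  have hσS : ∀ c, σ c ∈ S ↔ c ∈ S := by
    intro c
    by_cases hc : c ∈ S
    · simp [σ, hc, hS]
    · simp [σ, hc]
  have hw : ∀ c, walkStep arc d S c = arc (σ c) := fun c => rfl
  set n := returnTime arc d S a with hn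
  let p : ℕ → C := fun k => (walkStep arc d S)^[k] a
  have hp : ∀ k, p (k + 1) = arc (σ (p k)) := fun k => by
    simp only [p, iterate_succ_apply', hw]
  have hend : p (n + 1) ∉ S := reroute_notMem harc hd hS ha
  have hσ' : ∀ c, c ∉ S → σ c = c := fun c hc => by simp [σ, hc]
  -- `Z` is the trace of the walk from `a` up to its first exit from `S`, with the detour partners
  -- added. It is closed under `arc` and `σ`, hence contains the whole class of `a`, and among its
  -- points only `p 0` and `p (n + 1)` lie outside `S`.
  let Z : C → Prop := fun c => ∃ k ≤ n + 1, c = p k ∨ c = σ (p k)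
  have hZarc : ∀ c, Z c → Z (arc c) := by
    rintro c ⟨k, hk, hc⟩
    have back : ∀ k ≤ n + 1, Z (arc (p k)) := by
      rintro (_ | k) hk
      · refine ⟨1, by omega, Or.inl ?_⟩
        rw [hp 0, hσ' (p 0) ha]
      · exact ⟨k, by omega, Or.inr (by rw [hp, harc])⟩
    rcases hc with rfl | rfl
    · exact back k hk
    · rcases hk.lt_or_eq with hk | rfl
      · exact ⟨k + 1, by omega, Or.inl (hp k).symm⟩
      · rw [hσ' _ hend]
        exact back _ le_rfl
  have hZσ : ∀ c, Z c → Z (σ c) := by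
    rintro c ⟨k, hk, rfl | rfl⟩
    · exact ⟨k, hk, Or.inr rfl⟩
    · exact ⟨k, hk, Or.inl (hσσ _)⟩
  have hZ : ∀ c c', r c c' → Z c = Z c' := by
    rintro c c' (rfl | ⟨hc, rfl⟩)
    · exact propext ⟨hZarc c, fun h => by simpa [harc c] using hZarc _ h⟩
    · have e : d c = σ c := by simp [σ, hc]
      rw [e]
      exact propext ⟨hZσ c, fun h => by simpa [hσσ c] using hZσ _ h⟩
  have hab : Z a = Z b := congrArg (Quot.lift Z hZ) h
  obtain ⟨k, hk, hbk⟩ : Z b := hab ▸ ⟨0, by omega, Or.inl rfl⟩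
  have hkS : p k ∉ S := by
    rcases hbk with rfl | rfl
    · exact hb
    · rwa [hσS] at hb
  have hbk' : b = p k := by
    rcases hbk with h | h
    · exact h
    · rw [h, hσ' _ hkS]
  rcases k with _ | k
  · exact Or.inl hbk'
  · right
    have hkn : ¬ k < n := fun hlt => hkS (mem_of_lt_return hlt)
    obtain rfl : k = n := by omega
    exact hbk'

/-- Rerouting around `S` splits off the closed curves inside `S` and preserves the others. -/
lemma card_quot_reroute [Finite C] {T : Type v} (harc : Involutive arc) (hd : Involutive d)
    (hS : ∀ c, d c ∈ S ↔ c ∈ S) {δ : C → C} (hδ : ∀ c ∈ S, δ c = d c) {ι : T → C} (hι : Injective ι) (hrange : ∀ c, c ∉ S ↔ ∃ t, ι t = c)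
    {arc' δ' : T → T} (harc' : ∀ t, ι (arc' t) = reroute arc d S (ι t))
    (hδ' : ∀ t, ι (δ' t) = δ (ι t)) :
    Nat.card (Quot fun c c' : C => c' = arc c ∨ c' = δ c) =
      Nat.card (Quot fun t t' : T => t' = arc' t ∨ t' = δ' t) +
      Nat.card {q : Quot (fun c c' : C => c' = arc c ∨ c ∈ S ∧ c' = d c) //
        ∀ c, Quot.mk _ c = q → c ∈ S} := by
  classical
  have : Finite T := Finite.of_injective ι hι
  set r : C → C → Prop := fun c c' => c' = arc c ∨ c' = δ c with hr
  set r₀ : C → C → Prop := fun c c' => c' = arc c ∨ c ∈ S ∧ c' = d c with hr₀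
  set r₁ : T → T → Prop := fun t t' => t' = arc' t ∨ t' = δ' t with hr₁
  have hsub : ∀ c c', r₀ c c' → r c c' := by
    rintro c c' (h | ⟨hc, h⟩)
    · exact Or.inl h
    · exact Or.inr (h.trans (hδ c hc).symm)
  have hιS : ∀ t, ι t ∉ S := fun t => (hrange _).2 ⟨t, rfl⟩
  let inL : Quot r₁ → Quot r := Quot.lift (fun t => Quot.mk r (ι t)) (by
    rintro t t' (rfl | rfl)
    · rw [harc']
      exact (quot_mk_reroute_eq (r := r) (fun c => Or.inl rfl) (fun c hc => Or.inr (hδ c hc).symm) _).symm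
    · exact Quot.sound (Or.inr (hδ' t)))
  let inR : Quot r₀ → Quot r := Quot.lift (fun c => Quot.mk r c)
    fun c c' h => Quot.sound (hsub c c' h)
  let X := {q : Quot r₀ // ∀ c, Quot.mk _ c = q → c ∈ S}
  have hX : ∀ q : Quot r₀, (¬ ∃ t, Quot.mk r₀ (ι t) = q) → ∀ c, Quot.mk r₀ c = q → c ∈ S := by
    intro q hq c hc
    by_contra hcS
    obtain ⟨t, rfl⟩ := (hrange c).1 hcS
    exact hq ⟨t, hc⟩
  -- A class of `r₀` either stays inside `S` or is a path with its ends outside `S`. In the second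
  -- case the ends are exchanged by `reroute`, so the chosen end does not affect the class in `Quot
  -- r₁`.
  let F : Quot r₀ → Quot r₁ ⊕ X := fun q =>
    if h : ∃ t, Quot.mk r₀ (ι t) = q then Sum.inl (Quot.mk r₁ h.choose) else Sum.inr ⟨q, hX q h⟩
  have hF : ∀ t, F (Quot.mk r₀ (ι t)) = Sum.inl (Quot.mk r₁ t) := by
    intro t
    have h : ∃ t', Quot.mk r₀ (ι t') = Quot.mk r₀ (ι t) := ⟨t, rfl⟩
    simp only [F, dif_pos h]
    refine congrArg Sum.inl ?_
    rcases eq_or_eq_reroute harc hd hS (hιS _) (hιS _) h.choose_spec with e | e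
    · exact congrArg (Quot.mk r₁) (hι e).symm
    · exact Quot.sound (Or.inl (hι (e.trans (harc' _).symm)))
  let G : Quot r → Quot r₁ ⊕ X := Quot.lift (fun c => F (Quot.mk r₀ c)) (by
    rintro c c' (rfl | rfl)
    · exact congrArg F (Quot.sound (Or.inl rfl))
    · by_cases hc : c ∈ S
      · exact congrArg F (Quot.sound (Or.inr ⟨hc, hδ c hc⟩))
      · obtain ⟨t, rfl⟩ := (hrange c).1 hc
        rw [← hδ', hF, hF]
        exact congrArg Sum.inl (Quot.sound (Or.inr rfl)))
  have hcard : Nat.card (Quot r) = Nat.card (Quot r₁ ⊕ X) := by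
    refine Nat.card_congr ⟨G, Sum.elim inL fun x => inR x.1, ?_, ?_⟩
    · rintro ⟨c⟩
      change Sum.elim inL (fun x => inR x.1) (F (Quot.mk r₀ c)) = Quot.mk r c
      by_cases h : ∃ t, Quot.mk r₀ (ι t) = Quot.mk r₀ c
      · obtain ⟨t, ht⟩ := h
        rw [← ht, hF]
        exact congrArg inR ht
      · simp only [F, dif_neg h]
        rfl
    · rintro (t | ⟨⟨c⟩, hq⟩)
      · obtain ⟨t⟩ := t
        exact hF t
      · have h : ¬ ∃ t, Quot.mk r₀ (ι t) = Quot.mk r₀ c := fun ⟨t, ht⟩ => hιS t (hq _ ht)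
        change F (Quot.mk r₀ c) = _
        simp only [F, dif_neg h]
  rw [hcard, Nat.card_sum]

end Reroute

/-! ### Loop counts of spanning ribbon subgraphs -/

open Classical in
/-- The corner with which the boundary of the spanning ribbon subgraph on the edge set `A`
continues at a given corner. -/
def stateMap {E : Type u} (A : Set E) (c : E × Bool × Bool) : E × Bool × Bool :=
  if c.1 ∈ A then alongSide c else acrossEnd c

lemma acrossEnd_acrossEnd {E : Type u} (c : E × Bool × Bool) : acrossEnd (acrossEnd c) = c := by
  simp [acrossEnd]

lemma alongSide_alongSide {E : Type u} (c : E × Bool × Bool) : alongSide (alongSide c) = c := by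
  simp [alongSide]

lemma stateMap_fst {E : Type u} (A : Set E) (c : E × Bool × Bool) : (stateMap A c).1 = c.1 := by
  unfold stateMap
  split_ifs <;> rfl

lemma stateMap_involutive {E : Type u} (A : Set E) : Involutive (stateMap A) := by
  intro c
  by_cases h : c.1 ∈ A
  · have h' : (alongSide c).1 ∈ A := h
    simp [stateMap, h, h', alongSide_alongSide]
  · have h' : (acrossEnd c).1 ∉ A := h
    simp [stateMap, h, h', acrossEnd_acrossEnd]

lemma stateMap_ne {E : Type u} (A : Set E) (c : E × Bool × Bool) : stateMap A c ≠ c := by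
  unfold stateMap
  split_ifs <;> simp [alongSide, acrossEnd, Prod.ext_iff]

lemma stateMap_empty {E : Type u} : stateMap (∅ : Set E) = acrossEnd := by
  ext1 c
  simp [stateMap]

lemma stateMap_univ {E : Type u} : stateMap (Set.univ : Set E) = alongSide := by
  ext1 c
  simp [stateMap]

/-- The number of boundary components of the spanning ribbon subgraph on the edge set `A`. -/
def loops (G : RibbonGraph.{u}) (A : Set G.E) : ℕ :=
  Nat.card (Quot fun c c' : G.E × Bool × Bool => c' = G.arc c ∨ c' = stateMap A c) + G.isolated

variable (G : RibbonGraph.{u})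

lemma numV_eq_loops : G.numV = G.loops ∅ := by
  simp only [numV, loops, stateMap_empty, Vertex, Nat.card_sum, Nat.card_eq_fintype_card,
    Fintype.card_fin]

lemma numB_eq_loops : G.numB = G.loops Set.univ := by
  simp only [numB, loops, stateMap_univ, Boundary, Nat.card_sum, Nat.card_eq_fintype_card,
    Fintype.card_fin]

/-- The set `D` looks like `B` on `S` and like `A` elsewhere. Its curves inside `S` become the new
isolated vertices, which `loops` also counts; all other curves merely have their passages through
`S` shortcut. Deletion is `B = ∅`, contraction is `B = univ`, and a general `B` deletes some edges
of `S` and contracts the rest. -/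
lemma loops_remove {S : Set G.E} {d : G.E × Bool × Bool → G.E × Bool × Bool} (hd : Involutive d)
    (hd' : ∀ c, d c ≠ c) (hdE : ∀ c, (d c).1 = c.1) {B : Set G.E}
    (hB : ∀ c : G.E × Bool × Bool, c.1 ∈ S → d c = stateMap B c)
    {A : Set (G.remove S d hd hd' hdE).E} {D : Set G.E} (hDS : ∀ e ∈ S, e ∈ D ↔ e ∈ B)
    (hDA : ∀ e : {e // e ∉ S}, e.1 ∈ D ↔ e ∈ A) :
    (G.remove S d hd hd' hdE).loops A = G.loops D := by
  have key := card_quot_reroute (S := {x : G.E × Bool × Bool | x.1 ∈ S}) (arc := G.arc) (d := d)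
    G.arc_arc hd (fun x => by simp only [Set.mem_ofPred_eq, hdE x]) (δ := stateMap D)
    (fun c hc => by
      have hc' : c.1 ∈ S := hc
      rw [hB c hc']
      by_cases hcB : c.1 ∈ B
      · simp [stateMap, hcB, (hDS _ hc').2 hcB]
      · simp [stateMap, hcB, mt (hDS _ hc').1 hcB])
    (ι := liftCorner (S := S))
    (fun a b h => Prod.ext (Subtype.ext (congrArg (fun x => x.1) h)) (congrArg (fun x => x.2) h))
    (fun c => ⟨fun hc => ⟨(⟨c.1, hc⟩, c.2), rfl⟩, by rintro ⟨t, rfl⟩; exact t.1.2⟩)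
    (arc' := (G.remove S d hd hd' hdE).arc) (δ' := stateMap A) (fun t => rfl)
    (fun t => by
      have := hDA t.1
      by_cases h : t.1 ∈ A
      · have h' : (liftCorner t).1 ∈ D := this.2 h
        exact (congrArg liftCorner (if_pos h)).trans (if_pos h').symm
      · have h' : (liftCorner t).1 ∉ D := fun h' => h (this.1 h')
        exact (congrArg liftCorner (if_neg h)).trans (if_neg h').symm)
  unfold loops
  rw [key]
  change _ + (G.isolated + _) = _
  rw [add_comm G.isolated, ← add_assoc]
  rfl

lemma loops_delete {S : Set G.E} {A : Set (G.delete S).E} {D : Set G.E} (hDS : ∀ e ∈ S, e ∉ D)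
    (hDA : ∀ e : {e // e ∉ S}, e.1 ∈ D ↔ e ∈ A) : (G.delete S).loops A = G.loops D :=
  G.loops_remove _ _ _ (B := ∅) (fun c _ => by rw [stateMap_empty])
    (fun e he => by simpa using hDS e he) hDA

lemma loops_contract {S : Set G.E} {A : Set (G.contract S).E} {D : Set G.E} (hDS : S ⊆ D)
    (hDA : ∀ e : {e // e ∉ S}, e.1 ∈ D ↔ e ∈ A) : (G.contract S).loops A = G.loops D :=
  G.loops_remove _ _ _ (B := Set.univ) (fun c _ => by rw [stateMap_univ])
    (fun e he => by simpa using hDS he) hDA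

/-! ### Equivalent ribbon graphs -/

/-- `acrossEnd` and `alongSide` act transitively on the four corners of an edge, so a map of corners
commuting with both induces a map of edges. -/
lemma fst_eq_of_commute {E : Type u} {F : Type v} {f : E × Bool × Bool → F × Bool × Bool}
    (ha : ∀ c, f (acrossEnd c) = acrossEnd (f c)) (hs : ∀ c, f (alongSide c) = alongSide (f c))
    (c : E × Bool × Bool) : (f c).1 = (f (c.1, false, false)).1 := by
  have ha' : ∀ c, (f (acrossEnd c)).1 = (f c).1 := fun c => by rw [ha]; rfl
  have hs' : ∀ c, (f (alongSide c)).1 = (f c).1 := fun c => by rw [hs]; rfl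
  obtain ⟨e, _ | _, _ | _⟩ := c
  · rfl
  · exact ha' (e, false, false)
  · exact hs' (e, false, false)
  · exact (ha' (e, true, false)).trans (hs' (e, false, false))

variable {G} in
lemma Equivalent.exists_equiv {H : RibbonGraph.{v}} (h : G.Equivalent H) :
    ∃ ψ : G.E ≃ H.E, ∀ A, H.loops (ψ '' A) = G.loops A := by
  obtain ⟨⟨φ, harc, hacross, halong⟩, hiso⟩ := h
  have hacross' : ∀ c, φ.symm (acrossEnd c) = acrossEnd (φ.symm c) := fun c => by
    rw [Equiv.symm_apply_eq, hacross, Equiv.apply_symm_apply]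
  have halong' : ∀ c, φ.symm (alongSide c) = alongSide (φ.symm c) := fun c => by
    rw [Equiv.symm_apply_eq, halong, Equiv.apply_symm_apply]
  have hfst := fst_eq_of_commute hacross halong
  have hfst' := fst_eq_of_commute hacross' halong'
  let ψ : G.E ≃ H.E :=
    ⟨fun e => (φ (e, false, false)).1, fun e => (φ.symm (e, false, false)).1,
      fun e => (hfst' _).symm.trans (by rw [φ.symm_apply_apply]),
      fun e => (hfst _).symm.trans (by rw [φ.apply_symm_apply])⟩
  have hψ : ∀ c, (φ c).1 = ψ c.1 := hfst
  refine ⟨ψ, fun A => ?_⟩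
  unfold loops
  rw [hiso]
  congr 1
  refine (Nat.card_congr (Quot.congr φ fun c c' => ?_)).symm
  have hst : φ (stateMap A c) = stateMap (ψ '' A) (φ c) := by
    by_cases hc : c.1 ∈ A
    · simp [stateMap, hc, hψ, halong]
    · simp [stateMap, hc, hψ, hacross]
  rw [← harc, ← hst, φ.apply_eq_iff_eq, φ.apply_eq_iff_eq]

/-! ### Ribbon graphs with one edge -/

/-- The number of boundary components minus the number of vertices of a one-edge ribbon graph. -/
def Kind.shift : Kind → ℤ
  | .b => -1
  | .ol => 1
  | .nl => 0

/-- Here `f` labels the two closed curves and `g` picks a corner on each; every corner is the picked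
one of its curve or is joined to it by an arc. -/
lemma loops_oneEdge_same {k : Kind} {A : Set Unit} (f : Bool × Bool → Bool)
    (h : ∀ c c' : Unit × Bool × Bool,
      (c' = (oneEdge k).arc c ∨ c' = stateMap A c) → f c.2 = f c'.2)
    (g : Bool → Bool × Bool) (hfg : ∀ x, f (g x) = x)
    (hgf : ∀ c : Unit × Bool × Bool, ((), g (f c.2)) = c ∨ ((), g (f c.2)) = (oneEdge k).arc c) :
    (oneEdge k).loops A = 2 := by
  let r : Unit × Bool × Bool → Unit × Bool × Bool → Prop :=
    fun c c' => c' = (oneEdge k).arc c ∨ c' = stateMap A c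
  have : Nat.card (Quot r) = Nat.card Bool := by
    refine Nat.card_congr ⟨Quot.lift (fun c => f c.2) h, fun x => Quot.mk r ((), g x), ?_, hfg⟩
    rintro ⟨c⟩
    rcases hgf c with e | e
    · exact congrArg (Quot.mk r) e
    · exact (Quot.sound (r := r) (Or.inl e)).symm
  change Nat.card (Quot r) + 0 = 2
  rw [this]
  simp

lemma loops_oneEdge_ne {k : Kind} {A : Set Unit} (h : ∀ c : Unit × Bool × Bool,
      c = ((), false, false) ∨ c = (oneEdge k).arc ((), false, false) ∨
      c = stateMap A ((), false, false) ∨ c = stateMap A ((oneEdge k).arc ((), false, false))) :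
    (oneEdge k).loops A = 1 := by
  let r : Unit × Bool × Bool → Unit × Bool × Bool → Prop :=
    fun c c' => c' = (oneEdge k).arc c ∨ c' = stateMap A c
  have harc : ∀ c, Quot.mk r ((oneEdge k).arc c) = Quot.mk r c := fun c =>
    (Quot.sound (r := r) (Or.inl rfl)).symm
  have hst : ∀ c, Quot.mk r (stateMap A c) = Quot.mk r c := fun c =>
    (Quot.sound (r := r) (Or.inr rfl)).symm
  have : Nat.card (Quot r) = 1 := by
    rw [Nat.card_eq_one_iff_exists]
    refine ⟨Quot.mk r ((), false, false), ?_⟩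
    rintro ⟨c⟩
    rcases h c with e | e | e | e
    · exact congrArg (Quot.mk r) e
    · exact (congrArg (Quot.mk r) e).trans (harc _)
    · exact (congrArg (Quot.mk r) e).trans (hst _)
    · exact (congrArg (Quot.mk r) e).trans ((hst _).trans (harc _))
  change Nat.card (Quot r) + 0 = 1
  rw [this]

lemma loops_oneEdge_univ_sub (k : Kind) :
    ((oneEdge k).loops Set.univ : ℤ) - (oneEdge k).loops ∅ = k.shift := by
  cases k
  · have h1 : (oneEdge .b).loops (Set.univ : Set Unit) = 1 :=
      loops_oneEdge_ne (by simp [oneEdge, stateMap_univ, alongSide])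
    have h0 : (oneEdge .b).loops (∅ : Set Unit) = 2 :=
      loops_oneEdge_same (fun c => c.1) (by simp [oneEdge, stateMap_empty, acrossEnd])
        (fun x => (x, false)) (by simp) (by simp [oneEdge])
    exact congrArg₂ (fun m n : ℕ => (m : ℤ) - n) h1 h0
  · have h1 : (oneEdge .ol).loops (Set.univ : Set Unit) = 2 :=
      loops_oneEdge_same (fun c => c.2) (by simp [oneEdge, stateMap_univ, alongSide])
        (fun x => (false, x)) (by simp) (by simp [oneEdge])
    have h0 : (oneEdge .ol).loops (∅ : Set Unit) = 1 :=
      loops_oneEdge_ne (by simp [oneEdge, stateMap_empty, acrossEnd])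
    exact congrArg₂ (fun m n : ℕ => (m : ℤ) - n) h1 h0
  · have h1 : (oneEdge .nl).loops (Set.univ : Set Unit) = 1 :=
      loops_oneEdge_ne (by simp [oneEdge, stateMap_univ, alongSide])
    have h0 : (oneEdge .nl).loops (∅ : Set Unit) = 1 :=
      loops_oneEdge_ne (by simp [oneEdge, stateMap_empty, acrossEnd])
    exact congrArg₂ (fun m n : ℕ => (m : ℤ) - n) h1 h0

variable {G} in
lemma loops_univ_sub_of_equivalent {k : Kind} (h : G.dropIsolated.Equivalent (oneEdge k)) :
    (G.loops Set.univ : ℤ) - G.loops ∅ = k.shift := by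
  obtain ⟨ψ, hψ⟩ := h.exists_equiv
  have h1 := hψ Set.univ
  have h0 := hψ ∅
  rw [Set.image_univ, ψ.range_eq_univ] at h1
  rw [Set.image_empty] at h0
  have hk := loops_oneEdge_univ_sub k
  rw [h0, h1] at hk
  have e1 : G.loops Set.univ = G.dropIsolated.loops Set.univ + G.isolated := rfl
  have e0 : G.loops ∅ = G.dropIsolated.loops ∅ + G.isolated := rfl
  rw [e1, e0, ← hk]
  push_cast
  ring

/-- Four points have exactly three perfect matchings, and these are the arcs of `b`, `ol` and `nl`.
-/
lemma exists_kind_of_involutive (f : Bool × Bool → Bool × Bool) (hf : Involutive f)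
    (hne : ∀ x, f x ≠ x) : ∃ k : Kind, ∀ x, ((), f x) = (oneEdge k).arc ((), x) := by
  have key : ∀ a b c d : Bool × Bool, f (false, false) = a → f (false, true) = b →
      f (true, false) = c → f (true, true) = d →
      (∀ x, f x = (x.1, !x.2)) ∨ (∀ x, f x = (!x.1, x.2)) ∨ (∀ x, f x = (!x.1, !x.2)) := by
    intro a b c d ha hb hc hd
    have h1 := hf (false, false)
    have h2 := hf (false, true)
    have h3 := hf (true, false)
    have h4 := hf (true, true)
    have n1 := hne (false, false)
    have n2 := hne (false, true)
    have n3 := hne (true, false)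
    have n4 := hne (true, true)
    rcases a with ⟨_ | _, _ | _⟩ <;> rcases b with ⟨_ | _, _ | _⟩ <;>
      rcases c with ⟨_ | _, _ | _⟩ <;> rcases d with ⟨_ | _, _ | _⟩ <;> simp_all
  rcases key _ _ _ _ rfl rfl rfl rfl with h | h | h
  · exact ⟨.b, fun x => by rw [h]; rfl⟩
  · exact ⟨.ol, fun x => by rw [h]; rfl⟩
  · exact ⟨.nl, fun x => by rw [h]; rfl⟩

lemma exists_equivalent_oneEdge (e : G.E) (he : ∀ e', e' = e) :
    ∃ k, G.dropIsolated.Equivalent (oneEdge k) := by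
  let φ : G.E × Bool × Bool ≃ Unit × Bool × Bool :=
    ⟨fun c => ((), c.2), fun c => (e, c.2), fun c => Prod.ext (he c.1).symm rfl, fun c => rfl⟩
  have harc : ∀ c, G.arc c = (e, (G.arc (e, c.2)).2) := fun c => by
    conv_lhs => rw [show c = (e, c.2) from Prod.ext (he c.1) rfl]
    exact Prod.ext (he _) rfl
  obtain ⟨k, hk⟩ := exists_kind_of_involutive (fun x => (G.arc (e, x)).2)
    (fun x => by
      change (G.arc (e, (G.arc (e, x)).2)).2 = x
      rw [← harc (e, x), G.arc_arc])
    (fun x h => G.arc_ne (e, x) (Prod.ext (he _) h))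
  refine ⟨k, ⟨φ, fun c => ?_, fun c => rfl, fun c => rfl⟩, rfl⟩
  have := hk c.2
  change ((), (G.arc c).2) = (oneEdge k).arc ((), c.2)
  rw [← this, harc c]

/-! ### Edge types read off from boundary counts -/

lemma exists_isType (e : G.E) : ∃ i j, G.IsType e i j := by
  have hE : ∀ x : {x // x ∉ ({e}ᶜ : Set G.E)}, x = ⟨e, by simp⟩ := fun x =>
    Subtype.ext (by simpa using x.2)
  obtain ⟨i, hi⟩ := (G.contract {e}ᶜ).exists_equivalent_oneEdge ⟨e, by simp⟩ hE
  obtain ⟨j, hj⟩ := (G.delete {e}ᶜ).exists_equivalent_oneEdge ⟨e, by simp⟩ hE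
  exact ⟨i, j, hi, hj⟩

variable {G} in
-- After contracting all edges but `e`, the vertices are the boundary components of G\e, while the
-- boundary components of G are unchanged.
lemma IsType.loops_univ_sub {e : G.E} {i j : Kind} (h : G.IsType e i j) :
    (G.loops Set.univ : ℤ) - G.loops {e}ᶜ = i.shift := by
  rw [← loops_univ_sub_of_equivalent h.1,
    G.loops_contract (A := Set.univ) (D := Set.univ) (Set.subset_univ _) (fun x => Iff.rfl),
    G.loops_contract (A := ∅) (D := {e}ᶜ) le_rfl (fun x => iff_of_false x.2 id)]

variable {G} in
lemma IsType.loops_singleton_sub {e : G.E} {i j : Kind} (h : G.IsType e i j) :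
    (G.loops {e} : ℤ) - G.loops ∅ = j.shift := by
  rw [← loops_univ_sub_of_equivalent h.2,
    G.loops_delete (A := Set.univ) (D := {e}) (by simp) (fun x => iff_of_true (by simpa using x.2) trivial),
    G.loops_delete (A := ∅) (D := ∅) (by simp) (fun x => Iff.rfl)]

/-! ### Bounds on the variation of the boundary count -/

lemma abs_loops_insert_sub_le (A : Set G.E) (e : G.E) (he : e ∉ A) :
    |(G.loops (insert e A) : ℤ) - G.loops A| ≤ 1 := by
  -- Contracting the edges in `A` and deleting the others except `e` leaves a ribbon graph with one
  -- edge, whose shift is -1, 0 or 1.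
  let H := G.remove {e}ᶜ (stateMap A) (stateMap_involutive A) (stateMap_ne A) (stateMap_fst A)
  have hE : ∀ x : {x // x ∉ ({e}ᶜ : Set G.E)}, x = ⟨e, by simp⟩ := fun x =>
    Subtype.ext (by simpa using x.2)
  obtain ⟨k, hk⟩ := H.exists_equivalent_oneEdge ⟨e, by simp⟩ hE
  have h := loops_univ_sub_of_equivalent hk
  rw [G.loops_remove _ _ _ (B := A) (A := Set.univ) (D := insert e A) (fun _ _ => rfl)
      (fun x hx => by simp at hx; simp [hx]) (fun x => iff_of_true (by simp [hE x]) trivial),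
    G.loops_remove _ _ _ (B := A) (A := ∅) (D := A) (fun _ _ => rfl)
      (fun x hx => by simp) (fun x => iff_of_false (by simpa [hE x] using he) id)] at h
  rw [h]
  cases k <;> simp [Kind.shift]

lemma abs_loops_union_sub_le (A : Set G.E) (D : Finset G.E) (hD : Disjoint A (D : Set G.E)) :
    |(G.loops (A ∪ D) : ℤ) - G.loops A| ≤ D.card := by
  classical
  induction D using Finset.induction_on with
  | empty => simp
  | insert e D he ih =>
    rw [Finset.coe_insert, Set.disjoint_insert_right] at hD
    have h1 := ih hD.2
    have h2 := G.abs_loops_insert_sub_le (A ∪ D) e (by simp [hD.1, he])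
    rw [Finset.coe_insert, Set.union_insert, Finset.card_insert_of_notMem he]
    rw [abs_le] at *
    push_cast
    constructor <;> linarith [h1.1, h1.2, h2.1, h2.2]

lemma abs_loops_sub_empty_le (A : Set G.E) : |(G.loops A : ℤ) - G.loops ∅| ≤ A.ncard := by
  classical
  have := G.abs_loops_union_sub_le ∅ A.toFinite.toFinset (by simp)
  rwa [Set.empty_union, Set.Finite.coe_toFinset, ← Set.ncard_eq_toFinset_card] at this

lemma abs_loops_univ_sub_le (A : Set G.E) :
    |(G.loops Set.univ : ℤ) - G.loops A| ≤ G.numE - A.ncard := by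
  classical
  have := G.abs_loops_union_sub_le A Aᶜ.toFinite.toFinset (by rw [Set.Finite.coe_toFinset]; exact disjoint_compl_right)
  rw [Set.Finite.coe_toFinset, ← Set.ncard_eq_toFinset_card, Set.union_compl_self] at this
  have hc := Set.ncard_add_ncard_compl A
  unfold numE
  rw [← hc]
  push_cast
  linarith

/-! ### The state sum -/

open MvPolynomial in
/-- The contribution to the state sum of a spanning ribbon subgraph with `n` edges and `l` boundary
components, in a ribbon graph with `m` edges, `p` vertices and `b` boundary components. -/
def stateWeight (m p b n l : ℕ) : Coeff :=
  X .gamma ^ l * X .sqrtAb ^ ((m : ℤ) - n - b + l).toNat * X .sqrtAol ^ ((m : ℤ) - n + b - l).toNat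
    * X .sqrtBb ^ ((n : ℤ) + p - l).toNat * X .sqrtBol ^ ((n : ℤ) - p + l).toNat

/-- The sum of the weights of all spanning ribbon subgraphs. -/
def stateSum (G : RibbonGraph.{u}) : Coeff :=
  ∑ A : Set G.E, stateWeight G.numE (G.loops ∅) (G.loops Set.univ) A.ncard (G.loops A)

/-- Restoring the edge raises the exponents of √a_b and √a_ol by 1 - shift(i) and 1 + shift(i),
which is the factor a_i. The bound `h` ensures that `toNat` truncates nothing. -/
lemma stateWeight_delete {i : Kind} {m p b b' n l : ℕ} (hb : (b : ℤ) - b' = i.shift)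
    (h : |(b' : ℤ) - l| ≤ m - n) :
    stateWeight (m + 1) p b n l = aCoeff i * stateWeight m p b' n l := by
  rw [abs_le] at h
  obtain ⟨h1, h2⟩ := h
  cases i <;> simp only [Kind.shift] at hb <;> unfold stateWeight aCoeff
  · rw [show (((m + 1 : ℕ) : ℤ) - n - b + l).toNat = ((m : ℤ) - n - b' + l).toNat + 2 by omega,
      show (((m + 1 : ℕ) : ℤ) - n + b - l).toNat = ((m : ℤ) - n + b' - l).toNat by omega]
    ring
  · rw [show (((m + 1 : ℕ) : ℤ) - n - b + l).toNat = ((m : ℤ) - n - b' + l).toNat by omega,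
      show (((m + 1 : ℕ) : ℤ) - n + b - l).toNat = ((m : ℤ) - n + b' - l).toNat + 2 by omega]
    ring
  · rw [show (((m + 1 : ℕ) : ℤ) - n - b + l).toNat = ((m : ℤ) - n - b' + l).toNat + 1 by omega,
      show (((m + 1 : ℕ) : ℤ) - n + b - l).toNat = ((m : ℤ) - n + b' - l).toNat + 1 by omega]
    ring

/-- Here `m - n` is unchanged, and the exponents of √b_b and √b_ol rise by 1 - shift(j) and 1 +
shift(j). -/
lemma stateWeight_contract {j : Kind} {m p p' b n l : ℕ} (hp : (p' : ℤ) - p = j.shift)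
    (h : |(l : ℤ) - p'| ≤ n) :
    stateWeight (m + 1) p b (n + 1) l = bCoeff j * stateWeight m p' b n l := by
  rw [abs_le] at h
  obtain ⟨h1, h2⟩ := h
  unfold stateWeight
  rw [show ((m + 1 : ℕ) : ℤ) - (n + 1 : ℕ) = (m : ℤ) - n by push_cast; ring]
  cases j <;> simp only [Kind.shift] at hp <;> unfold bCoeff
  · rw [show (((n + 1 : ℕ) : ℤ) + p - l).toNat = ((n : ℤ) + p' - l).toNat + 2 by omega,
      show (((n + 1 : ℕ) : ℤ) - p + l).toNat = ((n : ℤ) - p' + l).toNat by omega]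
    ring
  · rw [show (((n + 1 : ℕ) : ℤ) + p - l).toNat = ((n : ℤ) + p' - l).toNat by omega,
      show (((n + 1 : ℕ) : ℤ) - p + l).toNat = ((n : ℤ) - p' + l).toNat + 2 by omega]
    ring
  · rw [show (((n + 1 : ℕ) : ℤ) + p - l).toNat = ((n : ℤ) + p' - l).toNat + 1 by omega,
      show (((n + 1 : ℕ) : ℤ) - p + l).toNat = ((n : ℤ) - p' + l).toNat + 1 by omega]
    ring

/-! ### Deletion and contraction for the state sum -/

open Classical in
lemma sum_set_eq_add {E : Type u} {T : Type v} {M : Type w} [AddCommMonoid M] [Fintype (Set E)]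
    [Fintype (Set T)] {ι : T → E} (hι : Injective ι) (e : E) (h : ∀ x, x ≠ e ↔ ∃ t, ι t = x)
    (f : Set E → M) : ∑ A, f A = ∑ A : Set T, f (ι '' A) + ∑ A : Set T, f (insert e (ι '' A)) := by
  have hne : ∀ t, ι t ≠ e := fun t => (h _).2 ⟨t, rfl⟩
  have himage : ∀ A : Set E, e ∉ A → ι '' (ι ⁻¹' A) = A := fun A hA =>
    Set.image_preimage_eq_of_subset fun x hx => (h x).1 fun hxe => hA (hxe ▸ hx)
  have hnot : ∀ A : Set T, e ∉ ι '' A := fun A ⟨t, _, ht⟩ => hne t ht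
  have hpre : ∀ A : Set T, ι ⁻¹' (insert e (ι '' A)) = A := fun A => by
    ext t
    simp [hne, hι.eq_iff]
  let φ : Set T ⊕ Set T ≃ Set E :=
    ⟨Sum.elim (fun A => ι '' A) (fun A => insert e (ι '' A)),
      fun A => if e ∈ A then Sum.inr (ι ⁻¹' A) else Sum.inl (ι ⁻¹' A),
      by
        rintro (A | A)
        · simp only [Sum.elim_inl, if_neg (hnot A), Set.preimage_image_eq A hι]
        · simp only [Sum.elim_inr, if_pos (Set.mem_insert e _), hpre],
      fun A => by
        by_cases hA : e ∈ A
        · simp only [if_pos hA, Sum.elim_inr]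
          ext x
          by_cases hx : x = e
          · simp [hx, hA]
          · obtain ⟨t, rfl⟩ := (h x).1 hx
            simp [hι.eq_iff, hne]
        · simp only [if_neg hA, Sum.elim_inl, himage A hA]⟩
  rw [← Fintype.sum_equiv φ (fun s => f (φ s)) f (fun _ => rfl), Fintype.sum_sum_type]
  rfl

lemma numE_eq_add_one {G H : RibbonGraph.{u}} {ι : H.E → G.E} (hι : Injective ι) {e : G.E}
    (hrange : Set.range ι = {e}ᶜ) : G.numE = H.numE + 1 := by
  have h := Set.ncard_add_ncard_compl ({e} : Set G.E)
  rw [Set.ncard_singleton, ← hrange, ← Set.image_univ, Set.ncard_image_of_injective _ hι,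
    Set.ncard_univ, add_comm] at h
  exact h.symm

lemma sum_stateWeight_delete {G H : RibbonGraph.{u}} {ι : H.E → G.E} (hι : Injective ι) {e : G.E}
    (hrange : Set.range ι = {e}ᶜ) {i : Kind} (hH : ∀ A, H.loops A = G.loops (ι '' A))
    (hi : (G.loops Set.univ : ℤ) - G.loops {e}ᶜ = i.shift) :
    ∑ A : Set H.E, stateWeight G.numE (G.loops ∅) (G.loops Set.univ) (ι '' A).ncard
      (G.loops (ι '' A)) = aCoeff i * H.stateSum := by
  rw [stateSum, Finset.mul_sum]
  refine Finset.sum_congr rfl fun A _ => ?_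
  have h0 := hH ∅
  have hu := hH Set.univ
  rw [Set.image_empty] at h0
  rw [Set.image_univ, hrange] at hu
  rw [← hu] at hi
  rw [numE_eq_add_one hι hrange, Set.ncard_image_of_injective A hι, ← hH, ← h0]
  exact stateWeight_delete hi (H.abs_loops_univ_sub_le A)

lemma sum_stateWeight_contract {G H : RibbonGraph.{u}} {ι : H.E → G.E} (hι : Injective ι)
    {e : G.E} (hrange : Set.range ι = {e}ᶜ) {j : Kind}
    (hH : ∀ A, H.loops A = G.loops (insert e (ι '' A)))
    (hj : (G.loops {e} : ℤ) - G.loops ∅ = j.shift) :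
    ∑ A : Set H.E, stateWeight G.numE (G.loops ∅) (G.loops Set.univ) (insert e (ι '' A)).ncard
      (G.loops (insert e (ι '' A))) = bCoeff j * H.stateSum := by
  rw [stateSum, Finset.mul_sum]
  refine Finset.sum_congr rfl fun A _ => ?_
  have he : e ∉ ι '' A := fun h => by
    have := Set.image_subset_range ι A h
    rw [hrange] at this
    exact this rfl
  have h0 := hH ∅
  have hu := hH Set.univ
  rw [Set.image_empty, insert_empty_eq] at h0
  rw [Set.image_univ, hrange, Set.insert_eq, Set.union_compl_self] at hu
  rw [← h0] at hj
  rw [numE_eq_add_one hι hrange, Set.ncard_insert_of_notMem he,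
    Set.ncard_image_of_injective A hι, ← hH, ← hu]
  exact stateWeight_contract hj (H.abs_loops_sub_empty_le A)

lemma numE_delete_singleton (G : RibbonGraph.{u}) (e : G.E) :
    G.numE = (G.delete {e}).numE + 1 :=
  numE_eq_add_one (H := G.delete {e}) Subtype.val_injective Subtype.range_val

lemma numE_contract_singleton (G : RibbonGraph.{u}) (e : G.E) :
    G.numE = (G.contract {e}).numE + 1 :=
  numE_eq_add_one (H := G.contract {e}) Subtype.val_injective Subtype.range_val

theorem stateSum_eq {G : RibbonGraph.{u}} {e : G.E} {i j : Kind} (h : G.IsType e i j) :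
    G.stateSum = aCoeff i * (G.delete {e}).stateSum + bCoeff j * (G.contract {e}).stateSum := by
  rw [← sum_stateWeight_delete (G := G) (H := G.delete {e}) Subtype.val_injective
      Subtype.range_val (fun A => G.loops_delete (fun x hx => by rintro ⟨t, -, rfl⟩; exact t.2 hx)
        (fun x => Subtype.val_injective.mem_set_image)) h.loops_univ_sub,
    ← sum_stateWeight_contract (G := G) (H := G.contract {e}) Subtype.val_injective
      Subtype.range_val (fun A => G.loops_contract
        (Set.singleton_subset_iff.2 (Set.mem_insert _ _))
        (fun x => (or_iff_right x.2).trans Subtype.val_injective.mem_set_image))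
      h.loops_singleton_sub]
  -- `G.delete {e}` and `G.contract {e}` have the same edge type by definition, so a single `T`
  -- serves both sums.
  exact sum_set_eq_add (T := (G.delete {e}).E) Subtype.val_injective e
    (fun x => ⟨fun hx => ⟨⟨x, hx⟩, rfl⟩, by rintro ⟨t, rfl⟩; exact t.2⟩) _

lemma stateSum_of_isEmpty (G : RibbonGraph.{u}) (h : IsEmpty G.E) :
    G.stateSum = MvPolynomial.X .gamma ^ G.numV := by
  have hE : G.numE = 0 := Nat.card_of_isEmpty
  have hA : ∀ A : Set G.E, A = ∅ := fun A => Set.eq_empty_of_isEmpty A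
  rw [stateSum, Finset.sum_eq_single_of_mem ∅ (Finset.mem_univ _) fun A _ hne => (hne (hA A)).elim,
    hA Set.univ, numV_eq_loops, stateWeight, hE]
  simp

lemma Equivalent.stateSum_eq {G : RibbonGraph.{u}} {H : RibbonGraph.{v}} (h : G.Equivalent H) :
    G.stateSum = H.stateSum := by
  obtain ⟨ψ, hψ⟩ := h.exists_equiv
  have h1 := hψ Set.univ
  have h0 := hψ ∅
  rw [Set.image_univ, ψ.range_eq_univ] at h1
  rw [Set.image_empty] at h0
  refine Fintype.sum_equiv (Equiv.Set.congr ψ) _ _ fun A => ?_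
  change _ = stateWeight _ _ _ (ψ '' A).ncard (H.loops (ψ '' A))
  rw [hψ, h0, h1, Set.ncard_image_of_injective A ψ.injective, numE, numE, Nat.card_congr ψ]

/-! ### The state sum in terms of the Tutte polynomial -/

/-- The number of components cancels between 2(v - k) and the Euler genus. -/
lemma twoRho_eq (G : RibbonGraph.{u}) :
    G.twoRho = (G.loops ∅ : ℤ) + G.numE - G.loops Set.univ := by
  unfold twoRho rank eulerGenus
  rw [numV_eq_loops, numB_eq_loops]
  ring

lemma twoRhoOf_eq (G : RibbonGraph.{u}) (A : Set G.E) :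
    G.twoRhoOf A = (G.loops ∅ : ℤ) + A.ncard - G.loops A := by
  have hE : (G.delete Aᶜ).numE = A.ncard := by
    change Nat.card {x // x ∉ Aᶜ} = Nat.card A
    exact Nat.card_congr (Equiv.subtypeEquivRight fun x => not_not)
  have h0 : (G.delete Aᶜ).loops ∅ = G.loops ∅ :=
    G.loops_delete (fun _ _ h => h) (fun _ => Iff.rfl)
  have hu : (G.delete Aᶜ).loops Set.univ = G.loops A :=
    G.loops_delete (fun _ h => h) (fun x => iff_of_true (not_not.1 x.2) trivial)
  rw [twoRhoOf, twoRho_eq, hE, h0, hu]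

/-- With `r` = 2ρ(G) and `r'` = 2ρ(A), all exponents of the weight are integer combinations of 2p -
r, r - r', 2n - r' and 2m - r, which are the exponents on the right-hand side apart from that of
√b_b, which is r. The bounds `h1` and `h2` remove the truncations. -/
lemma map_stateWeight {K : Type w} [Field K] (φ : Coeff →+* K)
    (hφ : ∀ t : Indet, φ (MvPolynomial.X t) ≠ 0) {s : K} (hs : s ^ 2 = φ (MvPolynomial.X .gamma))
    {m p b n l : ℕ} (h1 : |(b : ℤ) - l| ≤ m - n) (h2 : |(l : ℤ) - p| ≤ n) {r r' : ℤ}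
    (hr : r = p + m - b) (hr' : r' = p + n - l) :
    φ (stateWeight m p b n l) =
      s ^ (2 * (p : ℤ) - r) * φ (MvPolynomial.X .sqrtBb) ^ r
        * φ (MvPolynomial.X .sqrtAol) ^ (2 * (m : ℤ) - r)
        * ((s * φ (MvPolynomial.X .sqrtAb) / φ (MvPolynomial.X .sqrtBb)) ^ (r - r')
          * (s * φ (MvPolynomial.X .sqrtBol) / φ (MvPolynomial.X .sqrtAol)) ^ (2 * (n : ℤ) - r'))
      := by
  have hs0 : s ≠ 0 := by
    rintro rfl
    exact hφ .gamma (by rw [← hs]; simp)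
  rw [abs_le] at h1 h2
  have hAol := hφ .sqrtAol
  have hBb := hφ .sqrtBb
  unfold stateWeight
  simp only [map_mul, map_pow]
  rw [← hs, ← pow_mul]
  simp only [← zpow_natCast]
  rw [Int.toNat_of_nonneg (by omega), Int.toNat_of_nonneg (by omega),
    Int.toNat_of_nonneg (by omega), Int.toNat_of_nonneg (by omega),
    show ((2 * l : ℕ) : ℤ) = (2 * (p : ℤ) - r) + (r - r') + (2 * n - r') by push_cast; omega,
    show (m : ℤ) - n - b + l = r - r' by omega,
    show (m : ℤ) - n + b - l = (2 * m - r) - (2 * n - r') by omega,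
    show (n : ℤ) + p - l = r - (r - r') by omega,
    show (n : ℤ) - p + l = 2 * n - r' by omega,
    zpow_add₀ hs0, zpow_add₀ hs0, zpow_sub₀ hAol, zpow_sub₀ hBb, div_zpow, div_zpow, mul_zpow,
    mul_zpow]
  -- With the four exponents made opaque, the integer powers are atoms and the identity is one of
  -- commutative algebra.
  generalize 2 * (p : ℤ) - r = x₁
  generalize r - r' = x₂
  generalize 2 * (n : ℤ) - r' = x₃
  generalize 2 * (m : ℤ) - r = x₄
  simp only [div_eq_mul_inv]
  ring

theorem map_stateSum (G : RibbonGraph.{u}) {K : Type w} [Field K] (φ : Coeff →+* K)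
    (hφ : ∀ t : Indet, φ (MvPolynomial.X t) ≠ 0) {s : K}
    (hs : s ^ 2 = φ (MvPolynomial.X .gamma)) :
    φ G.stateSum =
      s ^ (2 * (G.numV : ℤ) - G.twoRho) * φ (MvPolynomial.X .sqrtBb) ^ G.twoRho
        * φ (MvPolynomial.X .sqrtAol) ^ (2 * (G.numE : ℤ) - G.twoRho)
        * G.tutteCS (s * φ (MvPolynomial.X .sqrtAb) / φ (MvPolynomial.X .sqrtBb))
            (s * φ (MvPolynomial.X .sqrtBol) / φ (MvPolynomial.X .sqrtAol)) := by
  rw [stateSum, map_sum, tutteCS, Finset.mul_sum]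
  refine Finset.sum_congr rfl fun A _ => ?_
  rw [numV_eq_loops]
  exact map_stateWeight φ hφ hs (G.abs_loops_univ_sub_le A) (G.abs_loops_sub_empty_le A)
    G.twoRho_eq (G.twoRhoOf_eq A)

/-! ### Universality -/

lemma satisfiesRecursion_stateSum {𝒢 : Set RibbonGraph.{u}} (h𝒢 : MinorClosed 𝒢) :
    SatisfiesRecursion h𝒢 fun G => G.1.stateSum where
  deletion_contraction _ _ _ _ h := stateSum_eq h
  edgeless G h := G.1.stateSum_of_isEmpty h

/-- Any edge has some type, so the recursion at one arbitrary edge determines `U` from two members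
of `𝒢` with one edge fewer. -/
lemma SatisfiesRecursion.eq_stateSum {𝒢 : Set RibbonGraph.{u}} {h𝒢 : MinorClosed 𝒢}
    {U : 𝒢 → Coeff} (hU : SatisfiesRecursion h𝒢 U) (G : 𝒢) : U G = G.1.stateSum := by
  induction hn : G.1.numE generalizing G with
  | zero =>
    have h : IsEmpty G.1.E :=
      (Nat.card_eq_zero.1 hn).resolve_right fun h => h.not_finite inferInstance
    rw [hU.edgeless G h, stateSum_of_isEmpty _ h]
  | succ n ih =>
    have : Nonempty G.1.E := (Nat.card_pos_iff.1 (by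
      change 0 < G.1.numE
      omega)).1
    obtain ⟨e⟩ := this
    obtain ⟨i, j, h⟩ := G.1.exists_isType e
    rw [hU.deletion_contraction G e i j h, stateSum_eq h,
      ih ⟨G.1.delete {e}, _⟩ (Nat.add_right_cancel ((G.1.numE_delete_singleton e).symm.trans hn)),
      ih ⟨G.1.contract {e}, _⟩
        (Nat.add_right_cancel ((G.1.numE_contract_singleton e).symm.trans hn))]

end RibbonGraph
end

theorem mainTheorem12 (𝒢 : Set RibbonGraph.{u}) (h𝒢 : RibbonGraph.MinorClosed 𝒢) :
    (∃! U : 𝒢 → RibbonGraph.Coeff, RibbonGraph.SatisfiesRecursion h𝒢 U) ∧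
    ∀ U : 𝒢 → RibbonGraph.Coeff, RibbonGraph.SatisfiesRecursion h𝒢 U →
      -- `U` is well defined on equivalence classes of ribbon graphs
      (∀ G H : 𝒢, G.1.Equivalent H.1 → U G = U H) ∧
      -- The formula holds in every field `K` to which the ring of coefficients is mapped such that
      -- the indeterminates become invertible and `γ` has a square root `sγ`.  In particular it
      -- holds for the embedding of this ring into an algebraic closure of its field of fractions.
      ∀ (K : Type w) [Field K] (φ : RibbonGraph.Coeff →+* K),
        (∀ t : RibbonGraph.Indet, φ (MvPolynomial.X t) ≠ 0) →
        ∀ sγ : K, sγ ^ 2 = φ (MvPolynomial.X .gamma) →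
        ∀ G : 𝒢, φ (U G) =
          sγ ^ (2 * (G.1.numV : ℤ) - G.1.twoRho)
            * φ (MvPolynomial.X .sqrtBb) ^ G.1.twoRho
            * φ (MvPolynomial.X .sqrtAol) ^ (2 * (G.1.numE : ℤ) - G.1.twoRho)
            * G.1.tutteCS
                (sγ * φ (MvPolynomial.X .sqrtAb) / φ (MvPolynomial.X .sqrtBb))
                (sγ * φ (MvPolynomial.X .sqrtBol) / φ (MvPolynomial.X .sqrtAol)) := by
  have hS := RibbonGraph.satisfiesRecursion_stateSum h𝒢
  refine ⟨⟨_, hS, fun U hU => funext fun G => hU.eq_stateSum G⟩, fun U hU => ⟨fun G H h => ?_, ?_⟩⟩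
  · rw [hU.eq_stateSum, hU.eq_stateSum, h.stateSum_eq]
  · intro K _ φ hφ sγ hs G
    rw [hU.eq_stateSum]
    exact G.1.map_stateSum φ hφ hs
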